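/- **Inconsistent canonicity.** Fix disjoint sets of positive atoms $X^+$ and of negative atoms $X^-$. *Types and contexts.* Negative types are $N ::= X^- \mid P \to N \mid N_1 \times N_2 \mid 1 \mid \langle P\rangle^-$ and positive types are $P ::= X^+ \mid P_1 + P_2 \mid 0 \mid \langle N\rangle^+$. Write $Q$ for a positive type or a negative atom. A negative/atomic context $\Gamma$ assigns to its variables negative types or positive atoms. Put $\langle N\rangle^{+}_{a} = \langle N\rangle^+$, $\langle X^+\rangle^{+}_{a} = X^+$, $\langle P\rangle^{-}_{a} = \langle P\rangle^-$, $\langle X^-\rangle^{-}_{a} = X^-$. Let $\lfloor\cdot\rfloor$ erase the shifts $\langle\cdot\rangle^\pm$, giving ordinary simple types over all the atoms (functions, products, $1$, sums, $0$). $\Gamma \vdash 0$ means that some term of the full simply-typed $\lambda$-calculus has type $0$ in $\lfloor\Gamma\rfloor$. *Focused calculus.* In the invertible judgment $\Gamma;\Delta \vdash a : G$, $\Delta$ is a context of positive types and the goal $G$ is either $N \mid \emptyset$ or $\emptyset \mid Q$. Its rules are the following. - Right rules: introduction of $\to$ (adding the argument to $\Delta$), of $\times$ and of $1$, at goals $N\mid\emptyset$.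 - Left rules: $\mathsf{absurd}(x)$ for $x:0$ in $\Delta$; case analysis on $x:P_1+P_2$ in $\Delta$, which rebinds $x$ at type $P_i$ in branch $i$. - End of phase: if $\Delta = \langle\Gamma'\rangle^{+}_{a}$, pass to $\Gamma,\Gamma' \vdash f : Q$ when the goal is $\langle Q\rangle^{-}_{a}\mid\emptyset$ or $\emptyset\mid Q$. The judgment $\Gamma \vdash f : Q$ holds if $f$ is a positive neutral $p \Uparrow P = Q$, or a negative neutral $n \Downarrow X^- = Q$, or $\mathsf{let}\ x = n\ \mathsf{in}\ a$ with $n \Downarrow \langle P\rangle^-$ and $\Gamma; x:P \vdash a : \emptyset\mid Q$. Negative neutrals $\Gamma \vdash n \Downarrow N$ are variables of negative type, projections of negative neutrals, and applications of a negative neutral to a positive one. Positive neutrals $\Gamma \vdash p \Uparrow P$ are variables of positive atomic type, injections of positive neutrals, and, at type $\langle N\rangle^+$, terms $a$ with $\Gamma;\emptyset \vdash a : N\mid\emptyset$. The strong judgment $\Gamma \Uparrow_{s} P$ says that $P$ is the type of a term built by injections from variables of $\Gamma$, where a variable $x:N$ has type $\langle N\rangle^+$ and a variable $x:X^+$ has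 type $X^+$. *Selection functions.* A selection function $\mathrm{sel}$ maps a context $\Gamma$, a goal $Q$ and a set $S$ of pairs $(n,P)$ to a finite set of such pairs. It is valid if, for every $\Gamma$, $Q$ and every set $S$ of pairs such that $\Gamma \vdash n \Downarrow \langle P\rangle^-$ for all $(n,P)\in S$, we have $\mathrm{sel}_{\Gamma,Q}(S)\subseteq S$, and for each $(n,P)\in S$ either $\Gamma\Uparrow_{s} P$ or $(n',P)\in \mathrm{sel}_{\Gamma,Q}(S)$ for some $n'$. *Saturated calculus (relative to $\mathrm{sel}$).* The rules are those of the focused calculus with these changes. The end of an invertible phase passes to the saturation judgment $\Gamma;\Gamma' \vdash_{\mathrm{sat}} f : Q$, which keeps the old context $\Gamma$ and the new context $\Gamma'$ apart. Positive and negative neutrals may end saturation only when $\Gamma'=\emptyset$. The rule for $\mathsf{let}$ becomes: let $(\bar n,\bar P)$ be $\mathrm{sel}_{(\Gamma,\Gamma'),Q}(S)$, where $S$ is the set of all $(n,P)$ such that $\Gamma,\Gamma' \vdash n\Downarrow\langle P\rangle^-$ in the focused calculus and $n$ uses at least one variable of $\Gamma'$; if $\Gamma,\Gamma'; \bar x:\bar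 P \vdash_{\mathrm{sat}} a : \emptyset\mid Q$, then $\Gamma;\Gamma'\vdash_{\mathrm{sat}} \mathsf{let}\ \bar x=\bar n\ \mathsf{in}\ a : Q$. Terms are taken up to $\alpha$-equivalence, the binding of the finite set $\bar n$ being simultaneous. *Equality.* Let $\approx_{\mathrm{icc}}$ be the equivalence relation on the terms of a saturated judgment generated by the well-typed permutations, anywhere in a term, of two adjacent invertible rules (rules without premises included, e.g. $\mathsf{absurd}(x)\approx_{\mathrm{icc}}\lambda y.\,\mathsf{absurd}(x)$ and $\mathsf{absurd}(x)\approx_{\mathrm{icc}}\mathsf{absurd}(y)$). **Theorem.** Let $\mathrm{sel}$ be a valid selection function, $\Gamma$ a negative/atomic context and $Q$ a positive type or negative atom. If $\Gamma\vdash 0$, then for all $f,f'$ with $\emptyset;\Gamma\vdash_{\mathrm{sat}} f : Q$ and $\emptyset;\Gamma\vdash_{\mathrm{sat}} f' : Q$ we have $f\approx_{\mathrm{icc}} f'$. -/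

import Mathlib

universe u v

namespace FocusedLC

/-! ### Types, polarized types, erasure -/

/-- Types of the full simply-typed lambda-calculus over a type `A` of atoms. -/
inductive Ty (A : Type u) : Type u
  | atom : A → Ty A
  | arr : Ty A → Ty A → Ty A
  | prod : Ty A → Ty A → Ty A
  | unit : Ty A
  | sum : Ty A → Ty A → Ty A
  | zero : Ty A

mutual
/-- Negative types. The atoms are split once and for all into the positive
atoms `A` and the negative atoms `B`. -/
inductive NTy (A : Type u) (B : Type v) : Type (max u v)
  | atom : B → NTy A B
  | arr : PTy A B → NTy A B → NTy A B
  | prod : NTy A B → NTy A B → NTy A B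
  | unit : NTy A B
  | shift : PTy A B → NTy A B
/-- Positive types. -/
inductive PTy (A : Type u) (B : Type v) : Type (max u v)
  | atom : A → PTy A B
  | sum : PTy A B → PTy A B → PTy A B
  | zero : PTy A B
  | shift : NTy A B → PTy A B
end

/-- Negative types or positive atoms. -/
inductive NegAt (A : Type u) (B : Type v) : Type (max u v)
  | neg : NTy A B → NegAt A B
  | atom : A → NegAt A B

/-- Positive types or negative atoms. -/
inductive PosAt (A : Type u) (B : Type v) : Type (max u v)
  | pos : PTy A B → PosAt A B
  | atom : B → PosAt A B

/-- Shift-or-atom, from negative-or-atomic to positive types. -/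
def NegAt.toPos {A : Type u} {B : Type v} : NegAt A B → PTy A B
  | .neg N => .shift N
  | .atom a => .atom a

/-- Shift-or-atom, from positive-or-atomic to negative types. -/
def PosAt.toNeg {A : Type u} {B : Type v} : PosAt A B → NTy A B
  | .pos P => .shift P
  | .atom b => .atom b

mutual
/-- Depolarization of negative types. -/
def NTy.erase {A : Type u} {B : Type v} : NTy A B → Ty (A ⊕ B)
  | .atom b => .atom (.inr b)
  | .arr P N => .arr P.erase N.erase
  | .prod N₁ N₂ => .prod N₁.erase N₂.erase
  | .unit => .unit
  | .shift P => P.erase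
/-- Depolarization of positive types. -/
def PTy.erase {A : Type u} {B : Type v} : PTy A B → Ty (A ⊕ B)
  | .atom a => .atom (.inl a)
  | .sum P₁ P₂ => .sum P₁.erase P₂.erase
  | .zero => .zero
  | .shift N => N.erase
end

/-- Depolarization of negative-or-atomic types. -/
def NegAt.erase {A : Type u} {B : Type v} : NegAt A B → Ty (A ⊕ B)
  | .neg N => N.erase
  | .atom a => .atom (.inl a)

/-! ### The full simply-typed lambda-calculus

Variables are de Bruijn levels throughout: variable `i` is the `i`-th entry of the
context and a binder binds the variable whose level is the length of the context.
Terms in a given context are thus taken up to alpha-equivalence. -/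

/-- Terms; the Boolean in `proj` and `inj` is `false` for index 1, `true` for index 2. -/
inductive LTm : Type
  | var : ℕ → LTm
  | lam : LTm → LTm
  | app : LTm → LTm → LTm
  | pair : LTm → LTm → LTm
  | proj : Bool → LTm → LTm
  | unit : LTm
  | inj : Bool → LTm → LTm
  | case : LTm → LTm → LTm → LTm
  | absurd : LTm → LTm

/-- `LTyped Γ t T`: the typing judgment `Γ ⊢ t : T`. -/
inductive LTyped {A : Type u} : List (Ty A) → LTm → Ty A → Prop
  | var {Γ i T} : Γ[i]? = some T → LTyped Γ (.var i) T
  | lam {Γ t T U} : LTyped (Γ ++ [T]) t U → LTyped Γ (.lam t) (.arr T U)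
  | app {Γ t u T U} : LTyped Γ t (.arr T U) → LTyped Γ u T → LTyped Γ (.app t u) U
  | pair {Γ t u T U} : LTyped Γ t T → LTyped Γ u U → LTyped Γ (.pair t u) (.prod T U)
  | proj₁ {Γ t T U} : LTyped Γ t (.prod T U) → LTyped Γ (.proj false t) T
  | proj₂ {Γ t T U} : LTyped Γ t (.prod T U) → LTyped Γ (.proj true t) U
  | unit {Γ} : LTyped Γ .unit .unit
  | inj₁ {Γ t T U} : LTyped Γ t T → LTyped Γ (.inj false t) (.sum T U)
  | inj₂ {Γ t T U} : LTyped Γ t U → LTyped Γ (.inj true t) (.sum T U)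
  | case {Γ t u₁ u₂ T₁ T₂ U} : LTyped Γ t (.sum T₁ T₂) →
      LTyped (Γ ++ [T₁]) u₁ U → LTyped (Γ ++ [T₂]) u₂ U → LTyped Γ (.case t u₁ u₂) U
  | absurd {Γ t T} : LTyped Γ t .zero → LTyped Γ (.absurd t) T

/-- `Γ ⊢ T`: some term has type `T` in `Γ`. -/
def LProves {A : Type u} (Γ : List (Ty A)) (T : Ty A) : Prop := ∃ t, LTyped Γ t T

/-! ### Focused and saturated terms -/

/-- Raw focused and saturated terms. `absurd x` and `case x a₁ a₂` eliminate a variable;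
`case` binds the same variable `x` again, at the type of the branch, in each branch.
`letin ns a` is the simultaneous binding of the neutrals `ns` in `a`
(a singleton in the focused calculus). -/
inductive Tm : Type
  | var : ℕ → Tm
  | lam : Tm → Tm
  | pair : Tm → Tm → Tm
  | unit : Tm
  | absurd : ℕ → Tm
  | case : ℕ → Tm → Tm → Tm
  | letin : List Tm → Tm → Tm
  | app : Tm → Tm → Tm
  | proj : Bool → Tm → Tm
  | inj : Bool → Tm → Tm

/-- Variable `i` occurs in a term. -/
inductive Occurs (i : ℕ) : Tm → Prop
  | var : Occurs i (.var i)
  | lam {a} : Occurs i a → Occurs i (.lam a)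
  | pair₁ {a b} : Occurs i a → Occurs i (.pair a b)
  | pair₂ {a b} : Occurs i b → Occurs i (.pair a b)
  | absurd : Occurs i (.absurd i)
  | case₀ {a b} : Occurs i (.case i a b)
  | case₁ {x a b} : Occurs i a → Occurs i (.case x a b)
  | case₂ {x a b} : Occurs i b → Occurs i (.case x a b)
  | letNeu {n ns a} : n ∈ ns → Occurs i n → Occurs i (.letin ns a)
  | letBody {ns a} : Occurs i a → Occurs i (.letin ns a)
  | app₁ {n p} : Occurs i n → Occurs i (.app n p)
  | app₂ {n p} : Occurs i p → Occurs i (.app n p)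
  | proj {k n} : Occurs i n → Occurs i (.proj k n)
  | inj {k p} : Occurs i p → Occurs i (.inj k p)

/-- The goal `N | Q` of an invertible judgment, in which exactly one of the two
positions is non-empty: `neg N` is `N | ∅` and `pos Q` is `∅ | Q`. -/
inductive Goal (A : Type u) (B : Type v) : Type (max u v)
  | neg : NTy A B → Goal A B
  | pos : PosAt A B → Goal A B

mutual
/-- Focused invertible judgment `Γ; Δ ⊢ a : G`; the variables of `Δ` come after those of `Γ`.
The left rules change the type of a variable of `Δ` in place. -/
inductive Inv {A : Type u} {B : Type v} :
    List (NegAt A B) → List (PTy A B) → Tm → Goal A B → Prop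
  | lam {Γ Δ a P N} : Inv Γ (Δ ++ [P]) a (.neg N) → Inv Γ Δ (.lam a) (.neg (.arr P N))
  | pair {Γ Δ a b N₁ N₂} : Inv Γ Δ a (.neg N₁) → Inv Γ Δ b (.neg N₂) →
      Inv Γ Δ (.pair a b) (.neg (.prod N₁ N₂))
  | unit {Γ Δ} : Inv Γ Δ .unit (.neg .unit)
  | absurd {Γ Δ j G} : Δ[j]? = some .zero → Inv Γ Δ (.absurd (Γ.length + j)) G
  | case {Γ Δ j a b P₁ P₂ G} : Δ[j]? = some (.sum P₁ P₂) →
      Inv Γ (Δ.set j P₁) a G → Inv Γ (Δ.set j P₂) b G →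
      Inv Γ Δ (.case (Γ.length + j) a b) G
  | focNeg {Γ Γ' f Q} : Foc (Γ ++ Γ') f Q → Inv Γ (Γ'.map NegAt.toPos) f (.neg Q.toNeg)
  | focPos {Γ Γ' f Q} : Foc (Γ ++ Γ') f Q → Inv Γ (Γ'.map NegAt.toPos) f (.pos Q)
/-- Focused choice-of-focusing judgment `Γ ⊢ f : Q`. -/
inductive Foc {A : Type u} {B : Type v} :
    List (NegAt A B) → Tm → PosAt A B → Prop
  | up {Γ p P} : Up Γ p P → Foc Γ p (.pos P)
  | down {Γ n b} : Down Γ n (.atom b) → Foc Γ n (.atom b)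
  | letPos {Γ n a P Q} : Down Γ n (.shift P) → Inv Γ [P] a (.pos Q) → Foc Γ (.letin [n] a) Q
/-- Positive focus judgment `Γ ⊢ p ⇑ P`. -/
inductive Up {A : Type u} {B : Type v} :
    List (NegAt A B) → Tm → PTy A B → Prop
  | var {Γ i a} : Γ[i]? = some (.atom a) → Up Γ (.var i) (.atom a)
  | shift {Γ a N} : Inv Γ [] a (.neg N) → Up Γ a (.shift N)
  | inj₁ {Γ p P₁ P₂} : Up Γ p P₁ → Up Γ (.inj false p) (.sum P₁ P₂)
  | inj₂ {Γ p P₁ P₂} : Up Γ p P₂ → Up Γ (.inj true p) (.sum P₁ P₂)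
/-- Negative focus judgment `Γ ⊢ n ⇓ N`. -/
inductive Down {A : Type u} {B : Type v} :
    List (NegAt A B) → Tm → NTy A B → Prop
  | var {Γ i N} : Γ[i]? = some (.neg N) → Down Γ (.var i) N
  | proj₁ {Γ n N₁ N₂} : Down Γ n (.prod N₁ N₂) → Down Γ (.proj false n) N₁
  | proj₂ {Γ n N₁ N₂} : Down Γ n (.prod N₁ N₂) → Down Γ (.proj true n) N₂
  | app {Γ n p P N} : Down Γ n (.arr P N) → Up Γ p P → Down Γ (.app n p) N
end

/-- Strong positive judgment: `P` can be retrieved from `Γ` by the pattern `p`. -/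
inductive StrongUp {A : Type u} {B : Type v} (Γ : List (NegAt A B)) : Tm → PTy A B → Prop
  | neg {i N} : Γ[i]? = some (.neg N) → StrongUp Γ (.var i) (.shift N)
  | atom {i a} : Γ[i]? = some (.atom a) → StrongUp Γ (.var i) (.atom a)
  | inj₁ {p P₁ P₂} : StrongUp Γ p P₁ → StrongUp Γ (.inj false p) (.sum P₁ P₂)
  | inj₂ {p P₁ P₂} : StrongUp Γ p P₂ → StrongUp Γ (.inj true p) (.sum P₁ P₂)

/-- Selection functions. A pair `(n, P)` stands for an observation `n : shift P`; from a context,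
a goal and a set of observations, a finite set of observations is selected. -/
abbrev Selection (A : Type u) (B : Type v) : Type (max u v) :=
  List (NegAt A B) → PosAt A B → Set (Tm × PTy A B) → Finset (Tm × PTy A B)

/-- Valid selection functions: out of any set `S` of observations deducible from the context `Γ`,
a subset is selected that has a neutral of every observed type not retrievable from `Γ`. -/
structure Selection.Valid {A : Type u} {B : Type v} (sel : Selection A B) : Prop where
  subset : ∀ Γ Q (S : Set (Tm × PTy A B)),
    (∀ o ∈ S, Down Γ o.1 (.shift o.2)) → ∀ o ∈ sel Γ Q S, o ∈ S
  complete : ∀ Γ Q (S : Set (Tm × PTy A B)),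
    (∀ o ∈ S, Down Γ o.1 (.shift o.2)) →
    ∀ n P, (n, P) ∈ S → (∃ p, StrongUp Γ p P) ∨ ∃ n', (n', P) ∈ sel Γ Q S

/-- The new observations in the old context `Γ` and the new context `Γ'`: the neutrals
of shifted positive type over `Γ, Γ'` that use some variable of `Γ'`. -/
def newObs {A : Type u} {B : Type v} (Γ Γ' : List (NegAt A B)) : Set (Tm × PTy A B) :=
  {o | Down (Γ ++ Γ') o.1 (.shift o.2) ∧
    ∃ i, Γ.length ≤ i ∧ i < (Γ ++ Γ').length ∧ Occurs i o.1}

mutual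
/-- Saturated invertible judgment `Γ; Δ ⊢ a : G`. -/
inductive SInv {A : Type u} {B : Type v} (sel : Selection A B) :
    List (NegAt A B) → List (PTy A B) → Tm → Goal A B → Prop
  | lam {Γ Δ a P N} : SInv sel Γ (Δ ++ [P]) a (.neg N) →
      SInv sel Γ Δ (.lam a) (.neg (.arr P N))
  | pair {Γ Δ a b N₁ N₂} : SInv sel Γ Δ a (.neg N₁) → SInv sel Γ Δ b (.neg N₂) →
      SInv sel Γ Δ (.pair a b) (.neg (.prod N₁ N₂))
  | unit {Γ Δ} : SInv sel Γ Δ .unit (.neg .unit)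
  | absurd {Γ Δ j G} : Δ[j]? = some .zero → SInv sel Γ Δ (.absurd (Γ.length + j)) G
  | case {Γ Δ j a b P₁ P₂ G} : Δ[j]? = some (.sum P₁ P₂) →
      SInv sel Γ (Δ.set j P₁) a G → SInv sel Γ (Δ.set j P₂) b G →
      SInv sel Γ Δ (.case (Γ.length + j) a b) G
  | satNeg {Γ Γ' f Q} : Sat sel Γ Γ' f Q →
      SInv sel Γ (Γ'.map NegAt.toPos) f (.neg Q.toNeg)
  | satPos {Γ Γ' f Q} : Sat sel Γ Γ' f Q →
      SInv sel Γ (Γ'.map NegAt.toPos) f (.pos Q)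
/-- Saturation judgment `Γ; Γ' ⊢ f : Q` with old context `Γ` and new context `Γ'`.
In the rule `sat`, the selected finite set is bound as a list in a fixed enumeration, so that
terms that bind the same set of neutrals are literally equal. -/
inductive Sat {A : Type u} {B : Type v} (sel : Selection A B) :
    List (NegAt A B) → List (NegAt A B) → Tm → PosAt A B → Prop
  | sat {Γ Γ' a Q os} : os = (sel (Γ ++ Γ') Q (newObs Γ Γ')).toList →
      SInv sel (Γ ++ Γ') (os.map Prod.snd) a (.pos Q) →
      Sat sel Γ Γ' (.letin (os.map Prod.fst) a) Q
  | up {Γ p P} : SUp sel Γ p P → Sat sel Γ [] p (.pos P)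
  | down {Γ n b} : SDown sel Γ n (.atom b) → Sat sel Γ [] n (.atom b)
/-- Saturated positive focus judgment. -/
inductive SUp {A : Type u} {B : Type v} (sel : Selection A B) :
    List (NegAt A B) → Tm → PTy A B → Prop
  | var {Γ i a} : Γ[i]? = some (.atom a) → SUp sel Γ (.var i) (.atom a)
  | shift {Γ a N} : SInv sel Γ [] a (.neg N) → SUp sel Γ a (.shift N)
  | inj₁ {Γ p P₁ P₂} : SUp sel Γ p P₁ → SUp sel Γ (.inj false p) (.sum P₁ P₂)
  | inj₂ {Γ p P₁ P₂} : SUp sel Γ p P₂ → SUp sel Γ (.inj true p) (.sum P₁ P₂)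
/-- Saturated negative focus judgment. -/
inductive SDown {A : Type u} {B : Type v} (sel : Selection A B) :
    List (NegAt A B) → Tm → NTy A B → Prop
  | var {Γ i N} : Γ[i]? = some (.neg N) → SDown sel Γ (.var i) N
  | proj₁ {Γ n N₁ N₂} : SDown sel Γ n (.prod N₁ N₂) → SDown sel Γ (.proj false n) N₁
  | proj₂ {Γ n N₁ N₂} : SDown sel Γ n (.prod N₁ N₂) → SDown sel Γ (.proj true n) N₂
  | app {Γ n p P N} : SDown sel Γ n (.arr P N) → SUp sel Γ p P → SDown sel Γ (.app n p) N
end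

/-! ### Invertible commuting conversions -/

/-- One permutation of two adjacent invertible rules, anywhere in a raw term.
A rule without premises is permuted with another one by erasing or creating the latter. -/
inductive Permute : Tm → Tm → Prop
  | caseLam {x a b} :
      Permute (.case x (.lam a) (.lam b)) (.lam (.case x a b))
  | casePair {x a₁ a₂ b₁ b₂} :
      Permute (.case x (.pair a₁ a₂) (.pair b₁ b₂)) (.pair (.case x a₁ b₁) (.case x a₂ b₂))
  | caseUnit {x} : Permute (.case x .unit .unit) .unit
  | caseCase {x y a b c d} : x ≠ y →
      Permute (.case x (.case y a b) (.case y c d)) (.case y (.case x a c) (.case x b d))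
  | caseAbsurd {x y} : x ≠ y → Permute (.case x (.absurd y) (.absurd y)) (.absurd y)
  | absurdLam {x} : Permute (.absurd x) (.lam (.absurd x))
  | absurdPair {x} : Permute (.absurd x) (.pair (.absurd x) (.absurd x))
  | absurdUnit {x} : Permute (.absurd x) .unit
  | absurdAbsurd {x y} : Permute (.absurd x) (.absurd y)
  | lam {a a'} : Permute a a' → Permute (.lam a) (.lam a')
  | pair₁ {a a' b} : Permute a a' → Permute (.pair a b) (.pair a' b)
  | pair₂ {a b b'} : Permute b b' → Permute (.pair a b) (.pair a b')
  | case₁ {x a a' b} : Permute a a' → Permute (.case x a b) (.case x a' b)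
  | case₂ {x a b b'} : Permute b b' → Permute (.case x a b) (.case x a b')
  | letNeu {l r n n' a} : Permute n n' →
      Permute (.letin (l ++ n :: r) a) (.letin (l ++ n' :: r) a)
  | letBody {ns a a'} : Permute a a' → Permute (.letin ns a) (.letin ns a')
  | app₁ {n n' p} : Permute n n' → Permute (.app n p) (.app n' p)
  | app₂ {n p p'} : Permute p p' → Permute (.app n p) (.app n p')
  | proj {k n n'} : Permute n n' → Permute (.proj k n) (.proj k n')
  | inj {k p p'} : Permute p p' → Permute (.inj k p) (.inj k p')

/-- Equality modulo invertible commuting conversions of the terms that satisfy a typing judgment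
`J`: the equivalence relation generated by the permutations between well-typed terms. -/
def Icc (J : Tm → Prop) : Tm → Tm → Prop :=
  Relation.EqvGen fun t t' => J t ∧ J t' ∧ Permute t t'

end FocusedLC

namespace FocusedLC

-- In an inconsistent context, saturation can never stop at a neutral, so a saturated term is built
-- only from forced `letin`s, `case`s and `absurd`s. At each saturation step the set of bound
-- neutrals depends only on the contexts and the goal, so two terms can differ only in the order of
-- their invertible rules, which the permutations identify.
--
-- The invariant is `Saturates Γ (Γ ++ Γ')`: each positive type observable from the old context has
-- a leaf among the old and new variables. It is vacuous at the start (`saturates_nil`) and passes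
-- through a saturation step followed by any decomposition of the selected types
-- (`Selection.Valid.saturatesInv`). A neutral may end saturation only if `Γ'` is empty; then `Γ`
-- saturates itself, and every `let` in a focused proof of `0` can be skipped along a leaf already
-- present, which leaves a positive focus on `0`: impossible (`Saturates.consistent`).
--
-- Two bridges are needed. Inconsistency is given for the unfocused λ-calculus, and a Kripke model
-- over focused provability turns it into a focused proof of `0` (`NTy.reflect_reify`,
-- `LProves.prf_zero`). Validity of the selection speaks of terms, and `Prf.inhabited` and
-- `Down.prf` translate between terms and provability.

variable {A : Type u} {B : Type v}

/-! ### A term-free focused calculus -/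

/-- `Leaf P x`: decomposing a variable of type `P` may leave a variable of type `x`. -/
inductive Leaf : PTy A B → NegAt A B → Prop
  | atom {a} : Leaf (.atom a) (.atom a)
  | shift {N} : Leaf (.shift N) (.neg N)
  | inj₁ {P₁ P₂ x} : Leaf P₁ x → Leaf (.sum P₁ P₂) x
  | inj₂ {P₁ P₂ x} : Leaf P₂ x → Leaf (.sum P₁ P₂) x

theorem leaf_toPos_iff {x y : NegAt A B} : Leaf x.toPos y ↔ x = y := by
  constructor
  · intro h
    cases x <;> cases h <;> rfl
  · rintro rfl
    cases x
    · exact .shift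
    · exact .atom

theorem eq_of_forall₂_leaf {Γ xs : List (NegAt A B)}
    (h : List.Forall₂ Leaf (Γ.map NegAt.toPos) xs) : xs = Γ := by
  induction Γ generalizing xs with
  | nil => cases h; rfl
  | cons x Γ ih =>
    cases h with
    | cons h₁ h₂ => rw [← leaf_toPos_iff.1 h₁, ih h₂]

theorem forall₂_leaf_map (Γ : List (NegAt A B)) :
    List.Forall₂ Leaf (Γ.map NegAt.toPos) Γ := by
  induction Γ with
  | nil => exact .nil
  | cons x Γ ih => exact .cons (leaf_toPos_iff.2 rfl) ih

theorem NegAt.toPos_injective : Function.Injective (NegAt.toPos (A := A) (B := B)) := by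
  intro x y h
  cases x <;> cases y <;> cases h <;> rfl

theorem StrongUp.exists_leaf {Γ : List (NegAt A B)} {p : Tm} {P : PTy A B}
    (h : StrongUp Γ p P) : ∃ x, Leaf P x ∧ x ∈ Γ := by
  induction h with
  | neg h => exact ⟨_, .shift, List.mem_of_getElem? h⟩
  | atom h => exact ⟨_, .atom, List.mem_of_getElem? h⟩
  | inj₁ _ ih => exact ih.imp fun _ h => ⟨.inj₁ h.1, h.2⟩
  | inj₂ _ ih => exact ih.imp fun _ h => ⟨.inj₂ h.1, h.2⟩

/-- The conclusions of the term-free calculus. -/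
inductive Jdg (A : Type u) (B : Type v) : Type (max u v)
  | foc : PosAt A B → Jdg A B
  | up : PTy A B → Jdg A B
  | neg : NTy A B → Jdg A B
  | down : NTy A B → Jdg A B

/-- Focused provability, in which a positive hypothesis is decomposed at once. -/
inductive Prf : List (NegAt A B) → Jdg A B → Prop
  | focUp {w P} : Prf w (.up P) → Prf w (.foc (.pos P))
  | focDown {w b} : Prf w (.down (.atom b)) → Prf w (.foc (.atom b))
  | letPos {w P Q} : Prf w (.down (.shift P)) →
      (∀ x, Leaf P x → Prf (w ++ [x]) (.foc Q)) → Prf w (.foc Q)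
  | atom {w a} : .atom a ∈ w → Prf w (.up (.atom a))
  | shift {w N} : Prf w (.neg N) → Prf w (.up (.shift N))
  | inj₁ {w P₁ P₂} : Prf w (.up P₁) → Prf w (.up (.sum P₁ P₂))
  | inj₂ {w P₁ P₂} : Prf w (.up P₂) → Prf w (.up (.sum P₁ P₂))
  | arr {w P N} : (∀ x, Leaf P x → Prf (w ++ [x]) (.neg N)) → Prf w (.neg (.arr P N))
  | prod {w N₁ N₂} : Prf w (.neg N₁) → Prf w (.neg N₂) → Prf w (.neg (.prod N₁ N₂))
  | unit {w} : Prf w (.neg .unit)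
  | ret {w Q} : Prf w (.foc Q) → Prf w (.neg Q.toNeg)
  | var {w N} : .neg N ∈ w → Prf w (.down N)
  | proj₁ {w N₁ N₂} : Prf w (.down (.prod N₁ N₂)) → Prf w (.down N₁)
  | proj₂ {w N₁ N₂} : Prf w (.down (.prod N₁ N₂)) → Prf w (.down N₂)
  | app {w P N} : Prf w (.down (.arr P N)) → Prf w (.up P) → Prf w (.down N)

theorem append_singleton_subset {α : Type*} {w w' : List α} (h : w ⊆ w') (x : α) :
    w ++ [x] ⊆ w' ++ [x] := by
  intro y hy
  simp only [List.mem_append] at hy ⊢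
  exact hy.imp_left (@h y)

/-- Hypotheses are used only through membership, so weakening, exchange and contraction come at
once, without renaming of variables. -/
theorem Prf.mono {w w' : List (NegAt A B)} {J : Jdg A B} (h : Prf w J) (hw : w ⊆ w') :
    Prf w' J := by
  induction h generalizing w' with
  | focUp _ ih => exact .focUp (ih hw)
  | focDown _ ih => exact .focDown (ih hw)
  | letPos _ _ ih₁ ih₂ =>
    exact .letPos (ih₁ hw) fun x hx => ih₂ x hx (append_singleton_subset hw x)
  | atom h => exact .atom (hw h)
  | shift _ ih => exact .shift (ih hw)
  | inj₁ _ ih => exact .inj₁ (ih hw)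
  | inj₂ _ ih => exact .inj₂ (ih hw)
  | arr _ ih => exact .arr fun x hx => ih x hx (append_singleton_subset hw x)
  | prod _ _ ih₁ ih₂ => exact .prod (ih₁ hw) (ih₂ hw)
  | unit => exact .unit
  | ret _ ih => exact .ret (ih hw)
  | var h => exact .var (hw h)
  | proj₁ _ ih => exact .proj₁ (ih hw)
  | proj₂ _ ih => exact .proj₂ (ih hw)
  | app _ _ ih₁ ih₂ => exact .app (ih₁ hw) (ih₂ hw)

/-! ### Term-free provability and focused terms -/

/-- The left rules split a sum into its leaves; `zero` has no leaf and is closed by `absurd`. -/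
theorem exists_inv_append_of_leaf {Γ : List (NegAt A B)} {Δ : List (PTy A B)} {G : Goal A B} :
    ∀ P : PTy A B, (∀ x, Leaf P x → ∃ a, Inv Γ (Δ ++ [x.toPos]) a G) →
      ∃ a, Inv Γ (Δ ++ [P]) a G
  | .atom _, h => h _ .atom
  | .shift _, h => h _ .shift
  | .zero, _ => ⟨_, .absurd (j := Δ.length) (by simp)⟩
  | .sum P₁ P₂, h => by
    obtain ⟨a, ha⟩ := exists_inv_append_of_leaf P₁ fun x hx => h x (.inj₁ hx)
    obtain ⟨b, hb⟩ := exists_inv_append_of_leaf P₂ fun x hx => h x (.inj₂ hx)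
    exact ⟨_, .case (j := Δ.length) (P₁ := P₁) (P₂ := P₂) (by simp)
      (by simpa using ha) (by simpa using hb)⟩

/-- Existence of focused terms for a conclusion of the term-free calculus. -/
def Jdg.Inhabited (w : List (NegAt A B)) : Jdg A B → Prop
  | .foc Q => ∃ f, Foc w f Q
  | .up P => ∃ p, Up w p P
  -- Arguments of λ-abstractions stay in the invertible zone until the phase ends, so every split of
  -- the context is needed.
  | .neg N => ∀ Γ xs, Γ ++ xs = w → ∃ a, Inv Γ (xs.map NegAt.toPos) a (.neg N)
  | .down N => ∃ n, Down w n N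

theorem Prf.inhabited {w : List (NegAt A B)} {J : Jdg A B} (h : Prf w J) : J.Inhabited w := by
  induction h with
  | focUp _ ih => exact ih.imp fun _ h => .up h
  | focDown _ ih => exact ih.imp fun _ h => .down h
  | @letPos w P Q _ _ ih₁ ih₂ =>
    obtain ⟨n, hn⟩ := ih₁
    obtain ⟨a, ha⟩ := exists_inv_append_of_leaf (Γ := w) (Δ := []) (G := .pos Q) P
      fun x hx => (ih₂ x hx).imp fun _ h => Inv.focPos (Γ' := [x]) h
    exact ⟨_, .letPos hn ha⟩
  | atom h =>
    obtain ⟨i, hi⟩ := List.mem_iff_getElem?.1 h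
    exact ⟨_, .var hi⟩
  | shift _ ih =>
    obtain ⟨a, ha⟩ := ih _ [] (List.append_nil _)
    exact ⟨a, .shift ha⟩
  | inj₁ _ ih => exact ih.elim fun _ h => ⟨_, .inj₁ h⟩
  | inj₂ _ ih => exact ih.elim fun _ h => ⟨_, .inj₂ h⟩
  | @arr w P N _ ih =>
    intro Γ xs hw
    obtain ⟨a, ha⟩ := exists_inv_append_of_leaf (Γ := Γ) (Δ := xs.map NegAt.toPos)
      (G := .neg N) P fun x hx => by
        simpa using ih x hx Γ (xs ++ [x]) (by rw [← List.append_assoc, hw])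
    exact ⟨_, .lam ha⟩
  | prod _ _ ih₁ ih₂ =>
    intro Γ xs hw
    obtain ⟨a, ha⟩ := ih₁ Γ xs hw
    obtain ⟨b, hb⟩ := ih₂ Γ xs hw
    exact ⟨_, .pair ha hb⟩
  | unit => exact fun Γ xs _ => ⟨_, .unit⟩
  | ret _ ih =>
    rintro Γ xs rfl
    exact ih.imp fun _ h => .focNeg h
  | var h =>
    obtain ⟨i, hi⟩ := List.mem_iff_getElem?.1 h
    exact ⟨_, .var hi⟩
  | proj₁ _ ih => exact ih.elim fun _ h => ⟨_, .proj₁ h⟩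
  | proj₂ _ ih => exact ih.elim fun _ h => ⟨_, .proj₂ h⟩
  | app _ _ ih₁ ih₂ =>
    obtain ⟨n, hn⟩ := ih₁
    obtain ⟨p, hp⟩ := ih₂
    exact ⟨_, .app hn hp⟩

/-- The conclusion of the term-free calculus that corresponds to a goal. -/
def Goal.jdg : Goal A B → Jdg A B
  | .neg N => .neg N
  | .pos Q => .foc Q

/-- `w` contains the types in `Γ` of the variables of the term `t`. -/
def Covers (Γ w : List (NegAt A B)) (t : Tm) : Prop :=
  ∀ i x, Occurs i t → Γ[i]? = some x → x ∈ w

theorem Covers.of_occurs {Γ w : List (NegAt A B)} {t t' : Tm} (h : Covers Γ w t)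
    (ht : ∀ i, Occurs i t' → Occurs i t) : Covers Γ w t' :=
  fun i x hi hx => h i x (ht i hi) hx

theorem Covers.append {Γ w : List (NegAt A B)} {t : Tm} (h : Covers Γ w t)
    (Γ' : List (NegAt A B)) : Covers (Γ ++ Γ') (w ++ Γ') t := by
  intro i x hi hx
  rw [List.getElem?_append] at hx
  split at hx
  · exact List.mem_append_left _ (h i x hi hx)
  · exact List.mem_append_right _ (List.mem_of_getElem? hx)

/-- With `R := Leaf`, a chosen decomposition tells which branch of a `case` to follow, and it also
decomposes the context of that branch. -/
theorem forall₂_set_left {α β : Type*} {R : α → β → Prop} {l : List α} {j : ℕ} {a : α}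
    {l' : List β} (h : List.Forall₂ R l l') (hj : l[j]? = some a) :
    ∃ y ∈ l', R a y ∧ ∀ a', R a' y → List.Forall₂ R (l.set j a') l' := by
  induction h generalizing j with
  | nil => simp at hj
  | @cons b y l l' hb hl ih =>
    cases j with
    | zero =>
      simp only [List.getElem?_cons_zero, Option.some.injEq] at hj
      subst hj
      exact ⟨y, by simp, hb, fun _ h => .cons h hl⟩
    | succ j =>
      obtain ⟨z, hz, h₁, h₂⟩ := ih (by simpa using hj)
      exact ⟨z, by simp [hz], h₁, fun a' h => .cons hb (h₂ a' h)⟩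

/-- A focused term proves its type from the variables that it uses. -/
theorem Down.prf {Γ w : List (NegAt A B)} {n : Tm} {N : NTy A B} (h : Down Γ n N)
    (hw : Covers Γ w n) : Prf w (.down N) := by
  -- Fixing a decomposition `xs` of `Δ` in `motive_1` selects one branch at each `case` and rules
  -- out `absurd`.
  refine Down.rec
    (motive_1 := fun Γ Δ a G _ => ∀ w xs, Covers Γ w a → List.Forall₂ Leaf Δ xs →
      Prf (w ++ xs) G.jdg)
    (motive_2 := fun Γ f Q _ => ∀ w, Covers Γ w f → Prf w (.foc Q))
    (motive_3 := fun Γ p P _ => ∀ w, Covers Γ w p → Prf w (.up P))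
    (motive_4 := fun Γ n N _ => ∀ w, Covers Γ w n → Prf w (.down N))
    ?_ ?_ ?_ ?_ ?_ ?_ ?_ ?_ ?_ ?_ ?_ ?_ ?_ ?_ ?_ ?_ ?_ ?_ h w hw
  · intro Γ Δ a P N _ ih w xs hw hx
    refine .arr fun x hl => ?_
    rw [List.append_assoc]
    exact ih w (xs ++ [x]) (hw.of_occurs fun _ => .lam)
      (List.rel_append hx (.cons hl .nil))
  · intro Γ Δ a b N₁ N₂ _ _ ih₁ ih₂ w xs hw hx
    exact .prod (ih₁ w xs (hw.of_occurs fun _ => .pair₁) hx)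
      (ih₂ w xs (hw.of_occurs fun _ => .pair₂) hx)
  · intro Γ Δ w xs _ _
    exact .unit
  · intro Γ Δ j G hj w xs _ hx
    obtain ⟨y, _, hy, _⟩ := forall₂_set_left hx hj
    cases hy
  · intro Γ Δ j a b P₁ P₂ G hj _ _ ih₁ ih₂ w xs hw hx
    obtain ⟨y, _, hy, h⟩ := forall₂_set_left hx hj
    cases hy with
    | inj₁ hy => exact ih₁ w xs (hw.of_occurs fun _ => .case₁) (h P₁ hy)
    | inj₂ hy => exact ih₂ w xs (hw.of_occurs fun _ => .case₂) (h P₂ hy)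
  · intro Γ Γ' f Q _ ih w xs hw hx
    obtain rfl := eq_of_forall₂_leaf hx
    exact .ret (ih _ (hw.append _))
  · intro Γ Γ' f Q _ ih w xs hw hx
    obtain rfl := eq_of_forall₂_leaf hx
    exact ih _ (hw.append _)
  · intro Γ p P _ ih w hw
    exact .focUp (ih w hw)
  · intro Γ n b _ ih w hw
    exact .focDown (ih w hw)
  · intro Γ n a P Q _ _ ih₁ ih₂ w hw
    exact .letPos (ih₁ w (hw.of_occurs fun _ => .letNeu (by simp)))
      fun x hx => ih₂ w [x] (hw.of_occurs fun _ => .letBody) (.cons hx .nil)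
  · intro Γ i a hi w hw
    exact .atom (hw i _ .var hi)
  · intro Γ a N _ ih w hw
    have := ih w [] hw .nil
    rw [List.append_nil] at this
    exact .shift this
  · intro Γ p P₁ P₂ _ ih w hw
    exact .inj₁ (ih w (hw.of_occurs fun _ => .inj))
  · intro Γ p P₁ P₂ _ ih w hw
    exact .inj₂ (ih w (hw.of_occurs fun _ => .inj))
  · intro Γ i N hi w hw
    exact .var (hw i _ .var hi)
  · intro Γ n N₁ N₂ _ ih w hw
    exact .proj₁ (ih w (hw.of_occurs fun _ => .proj))
  · intro Γ n N₁ N₂ _ ih w hw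
    exact .proj₂ (ih w (hw.of_occurs fun _ => .proj))
  · intro Γ n p P N _ _ ih₁ ih₂ w hw
    exact .app (ih₁ w (hw.of_occurs fun _ => .app₁)) (ih₂ w (hw.of_occurs fun _ => .app₂))

/-! ### Completeness of the term-free calculus -/

/-- Kripke semantics of types, with contexts as worlds; sums and `zero` are interpreted in
continuation-passing style. -/
def Ty.Holds : Ty (A ⊕ B) → List (NegAt A B) → Prop
  | .atom (.inl a), w => Prf w (.foc (.pos (.atom a)))
  | .atom (.inr b), w => Prf w (.foc (.atom b))
  | .arr T U, w => ∀ w', w ⊆ w' → T.Holds w' → U.Holds w'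
  | .prod T U, w => T.Holds w ∧ U.Holds w
  | .unit, _ => True
  | .sum T U, w => ∀ w' Q, w ⊆ w' → (∀ w'', w' ⊆ w'' → T.Holds w'' → Prf w'' (.foc Q)) →
      (∀ w'', w' ⊆ w'' → U.Holds w'' → Prf w'' (.foc Q)) → Prf w' (.foc Q)
  | .zero, w => ∀ Q, Prf w (.foc Q)

theorem Ty.Holds.mono {w w' : List (NegAt A B)} (hw : w ⊆ w') :
    ∀ {T : Ty (A ⊕ B)}, T.Holds w → T.Holds w'
  | .atom (.inl _), h => Prf.mono h hw
  | .atom (.inr _), h => Prf.mono h hw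
  | .arr _ _, h => fun w'' hw' => h w'' (List.Subset.trans hw hw')
  | .prod _ _, h => ⟨h.1.mono hw, h.2.mono hw⟩
  | .unit, _ => trivial
  | .sum _ _, h => fun w'' Q hw' => h w'' Q (List.Subset.trans hw hw')
  | .zero, h => fun Q => (h Q).mono hw

/-- The truth of a type is local for covers in continuation-passing style. -/
theorem Ty.holds_of_cover {F : List (NegAt A B) → Prop} :
    ∀ {T : Ty (A ⊕ B)} {w : List (NegAt A B)},
      (∀ w' Q, w ⊆ w' → (∀ w'', w' ⊆ w'' → F w'' → Prf w'' (.foc Q)) → Prf w' (.foc Q)) →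
      (∀ w', w ⊆ w' → F w' → T.Holds w') → T.Holds w
  | .atom (.inl _), w, hF, h => hF w _ (List.Subset.refl w) h
  | .atom (.inr _), w, hF, h => hF w _ (List.Subset.refl w) h
  | .arr _ _, _, hF, h => fun _ hw' hT => holds_of_cover
      (fun w'' Q hw'' => hF w'' Q (List.Subset.trans hw' hw''))
      fun w'' hw'' hw => h w'' (List.Subset.trans hw' hw'') hw w'' (List.Subset.refl w'') (hT.mono hw'')
  | .prod _ _, _, hF, h => ⟨holds_of_cover hF fun w' hw' hw => (h w' hw' hw).1,
      holds_of_cover hF fun w' hw' hw => (h w' hw' hw).2⟩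
  | .unit, _, _, _ => trivial
  | .sum _ _, _, hF, h => fun w' Q hw' h₁ h₂ => hF w' Q hw' fun w'' hw'' hw =>
      h w'' (List.Subset.trans hw' hw'') hw w'' Q (List.Subset.refl w'')
        (fun v hv => h₁ v (List.Subset.trans hw'' hv)) (fun v hv => h₂ v (List.Subset.trans hw'' hv))
  | .zero, w, hF, h => fun Q => hF w Q (List.Subset.refl w) fun w' hw' hw => h w' hw' hw Q

/-- Truth of `zero` says that the empty family covers `w`. -/
theorem Ty.holds_of_zero {w : List (NegAt A B)} (h : (Ty.zero : Ty (A ⊕ B)).Holds w)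
    (T : Ty (A ⊕ B)) : T.Holds w :=
  holds_of_cover (F := fun _ => False) (fun _ Q hw _ => (h Q).mono hw) fun _ _ h => h.elim

theorem holds_of_getElem?_append {Γ : List (Ty (A ⊕ B))} {T : Ty (A ⊕ B)}
    {w w' : List (NegAt A B)} (hw : w ⊆ w') (hΓ : ∀ (i : ℕ) (U : Ty (A ⊕ B)), Γ[i]? = some U → U.Holds w)
    (hT : T.Holds w') (i : ℕ) (U : Ty (A ⊕ B)) (hi : (Γ ++ [T])[i]? = some U) :
    U.Holds w' := by
  have hU := List.mem_of_getElem? hi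
  rw [List.mem_append, List.mem_singleton] at hU
  rcases hU with hU | rfl
  · obtain ⟨k, hk⟩ := List.mem_iff_getElem?.1 hU
    exact (hΓ k U hk).mono hw
  · exact hT

theorem LTyped.holds {Γ : List (Ty (A ⊕ B))} {t : LTm} {T : Ty (A ⊕ B)} (h : LTyped Γ t T)
    {w : List (NegAt A B)} (hΓ : ∀ (i : ℕ) (U : Ty (A ⊕ B)), Γ[i]? = some U → U.Holds w) : T.Holds w := by
  induction h generalizing w with
  | var h => exact hΓ _ _ h
  | lam _ ih => exact fun w' hw hT => ih (holds_of_getElem?_append hw hΓ hT)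
  | app _ _ ih₁ ih₂ => exact ih₁ hΓ w (List.Subset.refl w) (ih₂ hΓ)
  | pair _ _ ih₁ ih₂ => exact ⟨ih₁ hΓ, ih₂ hΓ⟩
  | proj₁ _ ih => exact (ih hΓ).1
  | proj₂ _ ih => exact (ih hΓ).2
  | unit => trivial
  | inj₁ _ ih => exact fun w' Q hw h₁ _ => h₁ w' (List.Subset.refl w') ((ih hΓ).mono hw)
  | inj₂ _ ih => exact fun w' Q hw _ h₂ => h₂ w' (List.Subset.refl w') ((ih hΓ).mono hw)
  | @case Γ t u₁ u₂ T₁ T₂ U _ _ _ ih ih₁ ih₂ =>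
    refine Ty.holds_of_cover (F := fun w => T₁.Holds w ∨ T₂.Holds w)
      (fun w' Q hw h => ih hΓ w' Q hw (fun v hv hT => h v hv (.inl hT))
        fun v hv hT => h v hv (.inr hT)) ?_
    rintro w' hw (hT | hT)
    · exact ih₁ (holds_of_getElem?_append hw hΓ hT)
    · exact ih₂ (holds_of_getElem?_append hw hΓ hT)
  | absurd _ ih => exact Ty.holds_of_zero (ih hΓ) _

/-- A proof of `foc (pos P)` is a tree of `let`s whose ends are positive foci on `P`; a proof of `Q`
is grafted at each end. -/
theorem Prf.foc_bind {w : List (NegAt A B)} {P : PTy A B} {Q : PosAt A B}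
    (h : Prf w (.foc (.pos P)))
    (hQ : ∀ w', w ⊆ w' → Prf w' (.up P) → Prf w' (.foc Q)) : Prf w (.foc Q) := by
  generalize hJ : Jdg.foc (.pos P) = J at h
  induction h with
  | focUp h => cases hJ; exact hQ _ (List.Subset.refl _) h
  | @letPos w P' Q' h _ _ ih =>
    exact .letPos h fun x hx => ih x hx
      (fun w' hw => hQ w' (List.Subset.trans (List.subset_append_left w [x]) hw)) hJ
  | _ => cases hJ

mutual
-- Normalization by evaluation, by mutual induction on polarized types: neutrals and leaves reflect
-- into the model, and the model reifies into focused proofs.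
theorem NTy.reflect_reify : ∀ N : NTy A B,
    (∀ w, Prf w (.down N) → N.erase.Holds w) ∧ ∀ w, N.erase.Holds w → Prf w (.neg N)
  | .atom b => ⟨fun w h => by rw [NTy.erase]; exact Prf.focDown h,
      fun w h => by rw [NTy.erase] at h; exact Prf.ret (Q := .atom b) h⟩
  | .unit => ⟨fun w _ => by rw [NTy.erase]; trivial, fun w _ => .unit⟩
  | .prod N₁ N₂ => by
    have h₁ := NTy.reflect_reify N₁
    have h₂ := NTy.reflect_reify N₂
    refine ⟨fun w h => ?_, fun w h => ?_⟩
    · rw [NTy.erase]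
      exact ⟨h₁.1 w (.proj₁ h), h₂.1 w (.proj₂ h)⟩
    · rw [NTy.erase] at h
      exact .prod (h₁.2 w h.1) (h₂.2 w h.2)
  | .arr P N => by
    have h₁ := PTy.reflect_reify P
    have h₂ := NTy.reflect_reify N
    refine ⟨fun w h => ?_, fun w h => ?_⟩
    · rw [NTy.erase]
      intro w' hw hP
      -- Reifying the argument yields only a `foc` proof, while application needs `up`; by
      -- `foc_bind` the worlds that prove `up P` form a cover.
      refine Ty.holds_of_cover (F := fun v => Prf v (.up P))
        (fun v Q hv hQ => ((h₁.2 w' hP).mono hv).foc_bind hQ) fun v hv hU => ?_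
      exact h₂.1 v (.app (h.mono (List.Subset.trans hw hv)) hU)
    · rw [NTy.erase] at h
      exact .arr fun x hx => h₂.2 _ (h _ (List.subset_append_left w [x])
        (h₁.1 _ x hx (by simp)))
  | .shift P => by
    have h₁ := PTy.reflect_reify P
    refine ⟨fun w h => ?_, fun w h => ?_⟩
    · rw [NTy.erase]
      -- The rule `letPos` says exactly that the worlds containing a leaf of `P` form a cover.
      refine Ty.holds_of_cover (F := fun v => ∃ x, Leaf P x ∧ x ∈ v)
        (fun v Q hv hQ => .letPos (h.mono hv) fun x hx =>
          hQ _ (List.subset_append_left v [x]) ⟨x, hx, by simp⟩) ?_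
      rintro v hv ⟨x, hx, hxv⟩
      exact h₁.1 v x hx hxv
    · rw [NTy.erase] at h
      exact Prf.ret (Q := .pos P) (h₁.2 w h)
theorem PTy.reflect_reify : ∀ P : PTy A B,
    (∀ w x, Leaf P x → x ∈ w → P.erase.Holds w) ∧
      ∀ w, P.erase.Holds w → Prf w (.foc (.pos P))
  | .atom a => ⟨fun w x hx hw => by
      cases hx; rw [PTy.erase]; exact Prf.focUp (.atom hw),
      fun w h => by rw [PTy.erase] at h; exact h⟩
  | .zero => ⟨fun w x hx _ => (nomatch hx), fun w h => by rw [PTy.erase] at h; exact h _⟩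
  | .shift N => by
    have h₁ := NTy.reflect_reify N
    refine ⟨fun w x hx hw => ?_, fun w h => ?_⟩
    · cases hx
      rw [PTy.erase]
      exact h₁.1 w (.var hw)
    · rw [PTy.erase] at h
      exact .focUp (.shift (h₁.2 w h))
  | .sum P₁ P₂ => by
    have h₁ := PTy.reflect_reify P₁
    have h₂ := PTy.reflect_reify P₂
    refine ⟨fun w x hx hw => ?_, fun w h => ?_⟩
    · rw [PTy.erase]
      cases hx with
      | inj₁ hx => exact fun v Q hv k _ => k v (List.Subset.refl v) (h₁.1 v x hx (hv hw))
      | inj₂ hx => exact fun v Q hv _ k => k v (List.Subset.refl v) (h₂.1 v x hx (hv hw))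
    · rw [PTy.erase] at h
      exact h w _ (List.Subset.refl w)
        (fun v _ hv => (h₁.2 v hv).foc_bind fun _ _ hp => .focUp (.inj₁ hp))
        (fun v _ hv => (h₂.2 v hv).foc_bind fun _ _ hp => .focUp (.inj₂ hp))
end

theorem NegAt.holds_erase {Γ : List (NegAt A B)} {x : NegAt A B} (hx : x ∈ Γ) :
    x.erase.Holds Γ := by
  cases x with
  | neg N => exact (NTy.reflect_reify N).1 Γ (.var hx)
  | atom a => exact Prf.focUp (.atom hx)

theorem LProves.prf_zero {Γ : List (NegAt A B)} (h : LProves (Γ.map NegAt.erase) .zero) :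
    Prf Γ (.foc (.pos .zero)) := by
  obtain ⟨t, ht⟩ := h
  refine ht.holds (w := Γ) (fun i U hi => ?_) (.pos .zero)
  obtain ⟨x, hx, rfl⟩ := List.mem_map.1 (List.mem_of_getElem? hi)
  exact NegAt.holds_erase hx

/-! ### Saturation -/

/-- Every observation over `Γ` is already decomposed in `w`. -/
def Saturates (Γ w : List (NegAt A B)) : Prop :=
  ∀ P, Prf Γ (.down (.shift P)) → ∃ x, Leaf P x ∧ x ∈ w

theorem Saturates.consistent {Γ : List (NegAt A B)} (hΓ : Saturates Γ Γ) :
    ¬ Prf Γ (.foc (.pos .zero)) := by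
  intro h
  suffices ∀ w J, Prf w J → J = .foc (.pos .zero) → w ⊆ Γ → False from
    this Γ _ h rfl (List.Subset.refl Γ)
  intro w J h hJ hw
  induction h with
  | focUp h => cases hJ; cases h
  | letPos h _ _ ih =>
    -- Only the branch of a leaf already in `Γ` is followed, so the context never leaves `Γ`.
    obtain ⟨x, hx, hxΓ⟩ := hΓ _ (h.mono hw)
    exact ih x hx hJ (List.append_subset.2 ⟨hw, by simpa using hxΓ⟩)
  | _ => cases hJ

/-- A negative neutral has a head variable, so the empty context has none. -/
theorem saturates_nil (w : List (NegAt A B)) : Saturates [] w := by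
  intro P h
  generalize hJ : Jdg.down (.shift P) = J, hw : ([] : List (NegAt A B)) = v at h
  suffices ∀ v J, Prf v J → v = ([] : List (NegAt A B)) → ∀ N : NTy A B, J ≠ .down N from
    (this v J h hw.symm _ hJ.symm).elim
  intro v J h hv
  induction h with
  | var h => subst hv; simp at h
  | proj₁ _ ih => exact fun N _ => ih hv _ rfl
  | proj₂ _ ih => exact fun N _ => ih hv _ rfl
  | app _ _ ih _ => exact fun N _ => ih hv _ rfl
  | _ => intro N h; cases h

/-- Every way to decompose `Δ` completes `Γ` to a context that saturates `Γ`. -/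
def SaturatesInv (Γ : List (NegAt A B)) (Δ : List (PTy A B)) : Prop :=
  ∀ xs, List.Forall₂ Leaf Δ xs → Saturates Γ (Γ ++ xs)

/-- An observation that uses a new variable is handled by validity: its type is retrievable from the
context or selected, hence decomposed in `xs`. Any other observation is already one over the old
context, where the invariant applies. -/
theorem Selection.Valid.saturatesInv {sel : Selection A B} (hsel : sel.Valid)
    {Γ Γ' : List (NegAt A B)} (h : Saturates Γ (Γ ++ Γ')) (Q : PosAt A B) :
    SaturatesInv (Γ ++ Γ') ((sel (Γ ++ Γ') Q (newObs Γ Γ')).toList.map Prod.snd) := by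
  intro xs hxs P hP
  obtain ⟨n, hn⟩ := hP.inhabited
  by_cases hocc : ∃ i, Γ.length ≤ i ∧ i < (Γ ++ Γ').length ∧ Occurs i n
  · rcases hsel.complete (Γ ++ Γ') Q (newObs Γ Γ') (fun _ h => h.1) n P ⟨hn, hocc⟩ with
      ⟨p, hp⟩ | ⟨n', hn'⟩
    · obtain ⟨x, hx, hxΓ⟩ := hp.exists_leaf
      exact ⟨x, hx, List.mem_append_left _ hxΓ⟩
    · have hmem : P ∈ (sel (Γ ++ Γ') Q (newObs Γ Γ')).toList.map Prod.snd :=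
        List.mem_map.2 ⟨(n', P), Finset.mem_toList.2 hn', rfl⟩
      obtain ⟨j, hj⟩ := List.mem_iff_getElem?.1 hmem
      obtain ⟨y, hy, hl, _⟩ := forall₂_set_left hxs hj
      exact ⟨y, hl, List.mem_append_right _ hy⟩
  · have hcov : Covers (Γ ++ Γ') Γ n := by
      intro i x hi hx
      have hlt : i < Γ.length := by
        by_contra hle
        exact hocc ⟨i, not_lt.1 hle, (List.getElem?_eq_some_iff.1 hx).1, hi⟩
      rw [List.getElem?_append_left hlt] at hx
      exact List.mem_of_getElem? hx
    obtain ⟨x, hx, hxΓ⟩ := h P (hn.prf hcov)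
    exact ⟨x, hx, List.mem_append_left _ hxΓ⟩

/-! ### Commuting conversions between saturated terms -/

theorem Icc.map {J J' : Tm → Prop} {g : Tm → Tm} (hJ : ∀ t, J t → J' (g t))
    (hg : ∀ t t', Permute t t' → Permute (g t) (g t')) {t t' : Tm} (h : Icc J t t') :
    Icc J' (g t) (g t') := by
  induction h with
  | rel _ _ h => exact .rel _ _ ⟨hJ _ h.1, hJ _ h.2.1, hg _ _ h.2.2⟩
  | refl => exact .refl _
  | symm _ _ _ ih => exact .symm _ _ ih
  | trans _ _ _ _ _ ih₁ ih₂ => exact .trans _ _ _ ih₁ ih₂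

variable {sel : Selection A B} {Γ : List (NegAt A B)} {Δ : List (PTy A B)} {Q : PosAt A B}

theorem SInv.inversion {a : Tm} (h : SInv sel Γ Δ a (.pos Q)) :
    (∃ j, Δ[j]? = some .zero ∧ a = .absurd (Γ.length + j)) ∨
    (∃ j P₁ P₂ a₁ a₂, Δ[j]? = some (.sum P₁ P₂) ∧ SInv sel Γ (Δ.set j P₁) a₁ (.pos Q) ∧
      SInv sel Γ (Δ.set j P₂) a₂ (.pos Q) ∧ a = .case (Γ.length + j) a₁ a₂) ∨
    ∃ Γ', Δ = Γ'.map NegAt.toPos ∧ Sat sel Γ Γ' a Q := by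
  cases h with
  | absurd hj => exact .inl ⟨_, hj, rfl⟩
  | case hj h₁ h₂ => exact .inr (.inl ⟨_, _, _, _, _, hj, h₁, h₂, rfl⟩)
  | satPos h => exact .inr (.inr ⟨_, rfl, h⟩)

theorem getElem?_map_toPos_ne_zero {Γ' : List (NegAt A B)} {j : ℕ} :
    (Γ'.map NegAt.toPos)[j]? ≠ some .zero := by
  intro h
  obtain ⟨x, _, hx⟩ := List.mem_map.1 (List.mem_of_getElem? h)
  cases x <;> cases hx

theorem getElem?_map_toPos_ne_sum {Γ' : List (NegAt A B)} {j : ℕ} {P₁ P₂ : PTy A B} :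
    (Γ'.map NegAt.toPos)[j]? ≠ some (.sum P₁ P₂) := by
  intro h
  obtain ⟨x, _, hx⟩ := List.mem_map.1 (List.mem_of_getElem? h)
  cases x <;> cases hx

theorem icc_case {j : ℕ} {P₁ P₂ : PTy A B} (hj : Δ[j]? = some (.sum P₁ P₂))
    {a₁ a₁' a₂ a₂' : Tm} (h₂ : SInv sel Γ (Δ.set j P₂) a₂ (.pos Q))
    (h₁' : SInv sel Γ (Δ.set j P₁) a₁' (.pos Q))
    (e₁ : Icc (SInv sel Γ (Δ.set j P₁) · (.pos Q)) a₁ a₁')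
    (e₂ : Icc (SInv sel Γ (Δ.set j P₂) · (.pos Q)) a₂ a₂') :
    Icc (SInv sel Γ Δ · (.pos Q)) (.case (Γ.length + j) a₁ a₂)
      (.case (Γ.length + j) a₁' a₂') :=
  .trans _ _ _
    (Icc.map (g := fun t => .case (Γ.length + j) t a₂) (fun _ ht => .case hj ht h₂)
      (fun _ _ => .case₁) e₁)
    (Icc.map (g := fun t => .case (Γ.length + j) a₁' t) (fun _ ht => .case hj h₁' ht)
      (fun _ _ => .case₂) e₂)

/-- In a context with a variable of type `zero`, all terms are equal to its elimination. -/
theorem icc_absurd {Δ : List (PTy A B)} {a : Tm} {j : ℕ} (hj : Δ[j]? = some .zero)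
    (h : SInv sel Γ Δ a (.pos Q)) :
    Icc (SInv sel Γ Δ · (.pos Q)) a (.absurd (Γ.length + j)) := by
  rcases h.inversion with ⟨k, hk, rfl⟩ | ⟨k, P₁, P₂, a₁, a₂, hk, h₁, h₂, rfl⟩ | ⟨Γ', rfl, _⟩
  · exact .rel _ _ ⟨h, .absurd hj, .absurdAbsurd⟩
  · have hne : k ≠ j := by
      rintro rfl
      rw [hk] at hj
      cases hj
    have hj₁ : (Δ.set k P₁)[j]? = some .zero := by rw [List.getElem?_set_ne hne, hj]
    have hj₂ : (Δ.set k P₂)[j]? = some .zero := by rw [List.getElem?_set_ne hne, hj]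
    exact .trans _ _ _
      (icc_case hk h₂ (.absurd hj₁) (icc_absurd hj₁ h₁) (icc_absurd hj₂ h₂))
      (.rel _ _ ⟨.case hk (.absurd hj₁) (.absurd hj₂), .absurd hj,
        .caseAbsurd (by simpa using hne)⟩)
  · exact (getElem?_map_toPos_ne_zero hj).elim
termination_by sizeOf a

/-- In a context with a variable of sum type, all terms are equal to a case analysis of it. -/
theorem exists_icc_case {Δ : List (PTy A B)} {a : Tm} {j : ℕ} {P₁ P₂ : PTy A B} (hj : Δ[j]? = some (.sum P₁ P₂))
    (h : SInv sel Γ Δ a (.pos Q)) :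
    ∃ a₁ a₂, SInv sel Γ (Δ.set j P₁) a₁ (.pos Q) ∧ SInv sel Γ (Δ.set j P₂) a₂ (.pos Q) ∧
      Icc (SInv sel Γ Δ · (.pos Q)) a (.case (Γ.length + j) a₁ a₂) := by
  rcases h.inversion with ⟨k, hk, rfl⟩ | ⟨k, R₁, R₂, b, c, hk, hb, hc, rfl⟩ | ⟨Γ', rfl, _⟩
  · have hne : j ≠ k := by
      rintro rfl
      rw [hk] at hj
      cases hj
    have h₁ : (Δ.set j P₁)[k]? = some .zero := by rw [List.getElem?_set_ne hne, hk]
    have h₂ : (Δ.set j P₂)[k]? = some .zero := by rw [List.getElem?_set_ne hne, hk]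
    exact ⟨_, _, .absurd h₁, .absurd h₂, .symm _ _ (.rel _ _
      ⟨.case hj (.absurd h₁) (.absurd h₂), h, .caseAbsurd (by simpa using hne)⟩)⟩
  · by_cases hne : k = j
    · subst hne
      rw [hk] at hj
      cases hj
      exact ⟨b, c, hb, hc, .refl _⟩
    · have hjR (R) : (Δ.set k R)[j]? = some (.sum P₁ P₂) := by
        rw [List.getElem?_set_ne hne, hj]
      have hkP (P) : (Δ.set j P)[k]? = some (.sum R₁ R₂) := by
        rw [List.getElem?_set_ne (Ne.symm hne), hk]
      obtain ⟨b₁, b₂, hb₁, hb₂, eb⟩ := exists_icc_case (hjR R₁) hb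
      obtain ⟨c₁, c₂, hc₁, hc₂, ec⟩ := exists_icc_case (hjR R₂) hc
      have e := icc_case hk hc (.case (hjR R₁) hb₁ hb₂) eb ec
      have hr := SInv.case hk (.case (hjR R₁) hb₁ hb₂) (.case (hjR R₂) hc₁ hc₂)
      rw [List.set_comm _ _ hne] at hb₁ hb₂ hc₁ hc₂
      have h₁ := SInv.case (hkP P₁) hb₁ hc₁
      have h₂ := SInv.case (hkP P₂) hb₂ hc₂
      exact ⟨_, _, h₁, h₂, .trans _ _ _ e (.rel _ _
        ⟨hr, .case hj h₁ h₂, .caseCase (by simpa using hne)⟩)⟩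
  · exact (getElem?_map_toPos_ne_sum hj).elim
termination_by sizeOf a

/-- Every decomposition after the replacement is also one of `Δ`. -/
theorem SaturatesInv.set {j : ℕ} {P P' : PTy A B} (h : SaturatesInv Γ Δ)
    (hj : Δ[j]? = some P) (hP : ∀ x, Leaf P' x → Leaf P x) : SaturatesInv Γ (Δ.set j P') := by
  intro xs hxs
  have hlt : j < Δ.length := (List.getElem?_eq_some_iff.1 hj).1
  obtain ⟨y, _, hy, h'⟩ := forall₂_set_left (j := j) (a := P') hxs
    (by simp [hlt])
  have hΔ := h' P (hP y hy)
  rw [List.set_set] at hΔ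
  obtain ⟨_, rfl⟩ := List.getElem?_eq_some_iff.1 hj
  rw [List.set_getElem_self] at hΔ
  exact h xs hΔ

/-- In an inconsistent context, saturation cannot end with a neutral. -/
theorem Sat.eq_letin {Γ' : List (NegAt A B)} {f : Tm} (h : Sat sel Γ Γ' f Q)
    (hs : Saturates Γ (Γ ++ Γ')) (h0 : Prf (Γ ++ Γ') (.foc (.pos .zero))) :
    ∃ a, f = .letin ((sel (Γ ++ Γ') Q (newObs Γ Γ')).toList.map Prod.fst) a ∧
      SInv sel (Γ ++ Γ') ((sel (Γ ++ Γ') Q (newObs Γ Γ')).toList.map Prod.snd) a (.pos Q) := by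
  cases h with
  | sat h ha => subst h; exact ⟨_, rfl, ha⟩
  | up _ => rw [List.append_nil] at hs h0; exact (hs.consistent h0).elim
  | down _ => rw [List.append_nil] at hs h0; exact (hs.consistent h0).elim

theorem Sat.letin_icc {Γ' : List (NegAt A B)} {a a' : Tm}
    (h : Icc (SInv sel (Γ ++ Γ') ((sel (Γ ++ Γ') Q (newObs Γ Γ')).toList.map Prod.snd) ·
      (.pos Q)) a a') :
    Icc (Sat sel Γ Γ' · Q)
      (.letin ((sel (Γ ++ Γ') Q (newObs Γ Γ')).toList.map Prod.fst) a)
      (.letin ((sel (Γ ++ Γ') Q (newObs Γ Γ')).toList.map Prod.fst) a') :=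
  Icc.map (g := fun t => .letin _ t) (fun _ ht => .sat rfl ht) (fun _ _ => .letBody) h

/-- The term `a` is reshaped to start with the same rule as `a'`, and the recursion descends in
`a'`. Once `Δ` is fully decomposed, both terms must bind the same neutrals. -/
theorem SInv.icc_of_inconsistent (hsel : sel.Valid) {Γ : List (NegAt A B)}
    {Δ : List (PTy A B)} {a a' : Tm} (hs : SaturatesInv Γ Δ)
    (h0 : Prf Γ (.foc (.pos .zero))) (h : SInv sel Γ Δ a (.pos Q))
    (h' : SInv sel Γ Δ a' (.pos Q)) : Icc (SInv sel Γ Δ · (.pos Q)) a a' := by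
  rcases h'.inversion with ⟨j, hj, rfl⟩ | ⟨j, P₁, P₂, b', c', hj, hb', hc', rfl⟩ | ⟨Γ', rfl, hf'⟩
  · exact icc_absurd hj h
  · obtain ⟨b, c, hb, hc, e⟩ := exists_icc_case hj h
    exact .trans _ _ _ e (icc_case hj hc hb'
      (SInv.icc_of_inconsistent hsel (hs.set hj fun _ => .inj₁) h0 hb hb')
      (SInv.icc_of_inconsistent hsel (hs.set hj fun _ => .inj₂) h0 hc hc'))
  · have hsat := hs Γ' (forall₂_leaf_map Γ')
    have h0' := h0.mono (List.subset_append_left Γ Γ')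
    rcases h.inversion with ⟨j, hj, rfl⟩ | ⟨j, P₁, P₂, b, c, hj, -, -, rfl⟩ | ⟨Γ'', hΓ, hf⟩
    · exact (getElem?_map_toPos_ne_zero hj).elim
    · exact (getElem?_map_toPos_ne_sum hj).elim
    · obtain rfl := List.map_injective_iff.2 NegAt.toPos_injective hΓ
      obtain ⟨b, rfl, hb⟩ := hf.eq_letin hsat h0'
      obtain ⟨b', rfl, hb'⟩ := hf'.eq_letin hsat h0'
      -- The end of the phase leaves no trace in the term, so only the typing judgment changes.
      exact Icc.map (g := id) (fun _ ht => .satPos ht) (fun _ _ h => h)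
        (Sat.letin_icc (SInv.icc_of_inconsistent hsel (hsel.saturatesInv hsat Q) h0' hb hb'))
termination_by sizeOf a'

end FocusedLC

theorem mainTheorem7 {A : Type u} {B : Type v}
    (sel : FocusedLC.Selection A B) (hsel : sel.Valid)
    (Γ : List (FocusedLC.NegAt A B))
    (hΓ : FocusedLC.LProves (Γ.map FocusedLC.NegAt.erase) .zero)
    (Q : FocusedLC.PosAt A B) (f f' : FocusedLC.Tm)
    (hf : FocusedLC.Sat sel [] Γ f Q) (hf' : FocusedLC.Sat sel [] Γ f' Q) :
    FocusedLC.Icc (fun t => FocusedLC.Sat sel [] Γ t Q) f f' := by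
  have h0 := hΓ.prf_zero
  have hs : FocusedLC.Saturates [] ([] ++ Γ) := FocusedLC.saturates_nil _
  obtain ⟨a, rfl, ha⟩ := hf.eq_letin hs h0
  obtain ⟨a', rfl, ha'⟩ := hf'.eq_letin hs h0
  exact FocusedLC.Sat.letin_icc
    (FocusedLC.SInv.icc_of_inconsistent hsel (hsel.saturatesInv hs Q) h0 ha ha')
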